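/- Let $R\subset\mathbb R^d\setminus\{0\}$ be a root system, i.e. a finite set with $\sigma_\alpha(R)\subseteq R$ for all $\alpha\in R$, where $\sigma_\alpha(x)=x-2\langle x,\alpha\rangle\alpha/\|\alpha\|^2$. Let $G$ be the group generated by the $\sigma_\alpha$, $\alpha\in R$. Fix $\beta\in\mathbb R^d$ with $\langle\alpha,\beta\rangle\neq0$ for all $\alpha\in R$, and put $R_+=\{\alpha\in R:\langle\alpha,\beta\rangle>0\}$. Let $k:R\to\mathbb C$ be $G$-invariant and put $\gamma=\sum_{\alpha\in R_+}k(\alpha)$. Let $\mathcal P=\mathbb C[\mathbb R^d]$, let $\mathcal P_n$ be its subspace of homogeneous polynomials of degree $n$, and for $\xi\in\mathbb R^d$ let $$T_\xi p(x)=\partial_\xi p(x)+\sum_{\alpha\in R_+}k(\alpha)\langle\alpha,\xi\rangle\frac{p(x)-p(\sigma_\alpha x)}{\langle\alpha,x\rangle},\qquad p\in\mathcal P,$$ be the Dunkl operators. Assume that for every $n\ge1$ the operator $p\mapsto(n+\gamma)p-\sum_{\alpha\in R_+}k(\alpha)\,p\circ\sigma_\alpha$ is invertible on $\mathcal P_n$.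 Then there is exactly one linear isomorphism $V_k$ of $\mathcal P$ with $V_k(\mathcal P_n)\subseteq\mathcal P_n$ for all $n\ge0$, $V_k(1)=1$ and $T_\xi V_k=V_k\partial_\xi$ for all $\xi\in\mathbb R^d$. With $E_n(x,y)=\frac1{n!}V_k(\langle\cdot,y\rangle^n)(x)$ and with $e^{-\Delta/2}=\sum_{m\ge0}\frac{(-1)^m}{2^m\,m!}\Delta^m$, where $\Delta$ is the Laplacian of $\mathbb R^d$, the series $$L_k(x,y)=\sum_{n=0}^\infty\bigl(e^{-\Delta/2}E_n(x,\cdot)\bigr)(y)$$ converges absolutely for all $x,y\in\mathbb R^d$. Moreover, for all $x,y\in\mathbb R^d$ and all $g\in G$, $$L_k(-x,y)=L_k(x,-y)\qquad\text{and}\qquad L_k(gx,y)=L_k(x,g^{-1}y).$$ -/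

import Mathlib

noncomputable section

namespace DunklKernel

/-- The reflection `σ_α(x) = x - 2 ⟨x, α⟩ α / ‖α‖²`. -/
def refl {d : ℕ} (α : EuclideanSpace ℝ (Fin d)) :
    EuclideanSpace ℝ (Fin d) ≃ₗᵢ[ℝ] EuclideanSpace ℝ (Fin d) :=
  (Submodule.span ℝ {α})ᗮ.reflection

/-- A (not necessarily reduced, crystallographic or spanning) root system in `ℝ^d`: a finite set
of nonzero vectors that is stable under the orthogonal reflections `σ_α` in the hyperplanes
`α^⊥`, for `α` in the set. -/
structure IsRootSystem {d : ℕ} (R : Finset (EuclideanSpace ℝ (Fin d))) : Prop where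
  zero_notMem : (0 : EuclideanSpace ℝ (Fin d)) ∉ R
  reflection_mem : ∀ α ∈ R, ∀ α' ∈ R, refl α α' ∈ R

lemma refl_apply {d : ℕ} (α x : EuclideanSpace ℝ (Fin d)) :
    refl α x = x - (2 * inner ℝ x α / ‖α‖ ^ 2) • α := by
  rw [refl, Submodule.reflection_orthogonal_apply, Submodule.reflection_singleton_apply,
    real_inner_comm, two_smul, mul_div_assoc, two_mul, add_smul]
  simp

/-- The reflection group `G` generated by the `σ_α`, `α ∈ R`. -/
def reflectionGroup {d : ℕ} (R : Finset (EuclideanSpace ℝ (Fin d))) :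
    Subgroup (EuclideanSpace ℝ (Fin d) ≃ₗᵢ[ℝ] EuclideanSpace ℝ (Fin d)) :=
  Subgroup.closure (refl '' (R : Set (EuclideanSpace ℝ (Fin d))))

open Classical in
/-- The positive subsystem `R₊ = {α ∈ R : ⟨α, β⟩ > 0}`. -/
def posRoots {d : ℕ} (R : Finset (EuclideanSpace ℝ (Fin d))) (β : EuclideanSpace ℝ (Fin d)) :
    Finset (EuclideanSpace ℝ (Fin d)) :=
  R.filter fun α => 0 < inner ℝ α β

/-- The value `p(x)` of a complex polynomial at a point `x ∈ ℝ^d`. -/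
def evalAt {d : ℕ} (x : EuclideanSpace ℝ (Fin d)) (p : MvPolynomial (Fin d) ℂ) : ℂ :=
  MvPolynomial.eval (fun i => ((x i : ℝ) : ℂ)) p

/-- The linear polynomial `⟨·, y⟩`. -/
def linForm {d : ℕ} (y : EuclideanSpace ℝ (Fin d)) : MvPolynomial (Fin d) ℂ :=
  ∑ i, MvPolynomial.C ((y i : ℝ) : ℂ) * MvPolynomial.X i

/-- The action `(L_g p)(x) = p(g x)` on polynomials (see `evalAt_act`): the coordinate `X_i` is
replaced by the `i`-th coordinate of `g x`. -/
def act {d : ℕ} (g : EuclideanSpace ℝ (Fin d) ≃ₗᵢ[ℝ] EuclideanSpace ℝ (Fin d)) :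
    MvPolynomial (Fin d) ℂ →ₐ[ℂ] MvPolynomial (Fin d) ℂ :=
  MvPolynomial.aeval fun i =>
    ∑ j, MvPolynomial.C ((g (EuclideanSpace.single j 1) i : ℝ) : ℂ) * MvPolynomial.X j

lemma evalAt_act {d : ℕ} (g : EuclideanSpace ℝ (Fin d) ≃ₗᵢ[ℝ] EuclideanSpace ℝ (Fin d))
    (p : MvPolynomial (Fin d) ℂ) (x : EuclideanSpace ℝ (Fin d)) :
    evalAt x (act g p) = evalAt (g x) p := by
  have key : ∀ i, (g x) i = ∑ j, g (EuclideanSpace.single j 1) i * x j := by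
    intro i
    have hx : x = ∑ j, x j • EuclideanSpace.single j (1 : ℝ) := by
      ext i
      simp [Finset.sum_apply, Pi.single_apply]
    conv_lhs => rw [hx]
    simp [map_sum, mul_comm]
  induction p using MvPolynomial.induction_on with
  | C a => simp [evalAt, act]
  | add p q hp hq => simp only [evalAt, map_add] at *; rw [hp, hq]
  | mul_X p i hp =>
    simp only [evalAt, map_mul] at *
    rw [hp]
    simp [act, key i]

/-- `p - L_{σ_α} p` is divisible by `⟨α, ·⟩` in the polynomial ring. -/
lemma linForm_dvd {d : ℕ} (α : EuclideanSpace ℝ (Fin d)) (p : MvPolynomial (Fin d) ℂ) :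
    linForm α ∣ p - act (refl α) p := by
  induction p using MvPolynomial.induction_on with
  | C a => simp [act]
  | add p q hp hq =>
    have h : p + q - act (refl α) (p + q) = (p - act (refl α) p) + (q - act (refl α) q) := by
      rw [map_add]; ring
    rw [h]; exact dvd_add hp hq
  | mul_X p i hp =>
    have hX : linForm α ∣ MvPolynomial.X i - act (refl α) (MvPolynomial.X i) := by
      refine ⟨MvPolynomial.C ((2 / ‖α‖ ^ 2 * α i : ℝ) : ℂ), ?_⟩
      have h1 : ∀ j, ((refl α (EuclideanSpace.single j 1)) i : ℝ)
          = (if i = j then 1 else 0) - 2 / ‖α‖ ^ 2 * α i * α j := by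
        intro j
        rw [refl_apply]
        simp [EuclideanSpace.inner_single_left]
        ring
      have h2 : act (refl α) (MvPolynomial.X i)
          = ∑ j, MvPolynomial.C ((refl α (EuclideanSpace.single j 1) i : ℝ) : ℂ)
            * MvPolynomial.X j := by simp [act]
      rw [h2, linForm, Finset.sum_mul]
      simp only [h1]
      have h3 : ∀ j : Fin d, MvPolynomial.C
            ((((if i = j then 1 else 0) - 2 / ‖α‖ ^ 2 * α i * α j : ℝ)) : ℂ)
            * (MvPolynomial.X j : MvPolynomial (Fin d) ℂ)
          = (if i = j then MvPolynomial.X j else 0)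
            - MvPolynomial.C ((α j : ℝ) : ℂ) * MvPolynomial.X j
              * MvPolynomial.C ((2 / ‖α‖ ^ 2 * α i : ℝ) : ℂ) := by
        intro j
        split_ifs <;> push_cast <;> simp only [map_sub, map_mul, map_one, map_zero] <;> ring
      simp only [h3, Finset.sum_sub_distrib]
      simp
    have h : p * MvPolynomial.X i - act (refl α) (p * MvPolynomial.X i)
        = (p - act (refl α) p) * MvPolynomial.X i
          + act (refl α) p * (MvPolynomial.X i - act (refl α) (MvPolynomial.X i)) := by
      rw [map_mul]; ring
    rw [h]
    exact dvd_add (hp.mul_right _) (hX.mul_left _)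

/-- The polynomial `x ↦ (p(x) - p(σ_α x)) / ⟨α, x⟩` (for `α ≠ 0`, where the quotient is
unique). -/
def divDiff {d : ℕ} (α : EuclideanSpace ℝ (Fin d)) (p : MvPolynomial (Fin d) ℂ) :
    MvPolynomial (Fin d) ℂ :=
  Classical.choose (linForm_dvd α p)

lemma linForm_mul_divDiff {d : ℕ} (α : EuclideanSpace ℝ (Fin d)) (p : MvPolynomial (Fin d) ℂ) :
    linForm α * divDiff α p = p - act (refl α) p :=
  (Classical.choose_spec (linForm_dvd α p)).symm

/-- The directional derivative `∂_ξ` on polynomials. -/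
def dirDeriv {d : ℕ} (ξ : EuclideanSpace ℝ (Fin d)) (p : MvPolynomial (Fin d) ℂ) :
    MvPolynomial (Fin d) ℂ :=
  ∑ j, ((ξ j : ℝ) : ℂ) • MvPolynomial.pderiv j p

/-- The Dunkl operator `T_ξ(k)` on polynomials:
`T_ξ p = ∂_ξ p + ∑_{α ∈ R₊} k(α) ⟨α, ξ⟩ (p - p ∘ σ_α) / ⟨α, ·⟩`. -/
def dunklOp {d : ℕ} (Rpos : Finset (EuclideanSpace ℝ (Fin d)))
    (k : EuclideanSpace ℝ (Fin d) → ℂ) (ξ : EuclideanSpace ℝ (Fin d))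
    (p : MvPolynomial (Fin d) ℂ) : MvPolynomial (Fin d) ℂ :=
  dirDeriv ξ p + ∑ α ∈ Rpos, (k α * ((inner ℝ α ξ : ℝ) : ℂ)) • divDiff α p

/-- `W_n = (n + γ) - A`, where `γ = ∑_{α ∈ R₊} k(α)` and `A = ∑_{α ∈ R₊} k(α) L_{σ_α}`. -/
def eulerOp {d : ℕ} (Rpos : Finset (EuclideanSpace ℝ (Fin d)))
    (k : EuclideanSpace ℝ (Fin d) → ℂ) (n : ℕ) (p : MvPolynomial (Fin d) ℂ) :
    MvPolynomial (Fin d) ℂ :=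
  ((n : ℂ) + ∑ α ∈ Rpos, k α) • p - ∑ α ∈ Rpos, k α • act (refl α) p

/-- The condition `k ∈ M*`: for every `n ≥ 1` the operator `W_n` is invertible on the space `𝒫_n`
of homogeneous polynomials of degree `n`. -/
def IsInvertibleParam {d : ℕ} (Rpos : Finset (EuclideanSpace ℝ (Fin d)))
    (k : EuclideanSpace ℝ (Fin d) → ℂ) : Prop :=
  ∀ n : ℕ, 1 ≤ n → Set.BijOn (eulerOp Rpos k n)
    (MvPolynomial.homogeneousSubmodule (Fin d) ℂ n : Set (MvPolynomial (Fin d) ℂ))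
    (MvPolynomial.homogeneousSubmodule (Fin d) ℂ n : Set (MvPolynomial (Fin d) ℂ))

/-- The properties that characterize the intertwining operator: `V 𝒫_n ⊆ 𝒫_n`, `V 1 = 1` and
`T_ξ V = V ∂_ξ` for all `ξ`. -/
structure IsIntertwining {d : ℕ} (Rpos : Finset (EuclideanSpace ℝ (Fin d)))
    (k : EuclideanSpace ℝ (Fin d) → ℂ)
    (V : MvPolynomial (Fin d) ℂ ≃ₗ[ℂ] MvPolynomial (Fin d) ℂ) : Prop where
  homogeneous : ∀ (n : ℕ) (p : MvPolynomial (Fin d) ℂ),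
    p ∈ MvPolynomial.homogeneousSubmodule (Fin d) ℂ n →
      V p ∈ MvPolynomial.homogeneousSubmodule (Fin d) ℂ n
  map_one : V 1 = 1
  intertwines : ∀ (ξ : EuclideanSpace ℝ (Fin d)) (p : MvPolynomial (Fin d) ℂ),
    dunklOp Rpos k ξ (V p) = V (dirDeriv ξ p)

open Classical in
/-- The intertwining operator `V_k`: the linear automorphism of the space of polynomials that
satisfies `IsIntertwining` (the identity, as a dummy value, if there is none). -/
def intertwiner {d : ℕ} (Rpos : Finset (EuclideanSpace ℝ (Fin d)))
    (k : EuclideanSpace ℝ (Fin d) → ℂ) :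
    MvPolynomial (Fin d) ℂ ≃ₗ[ℂ] MvPolynomial (Fin d) ℂ :=
  if h : ∃ V, IsIntertwining Rpos k V then Classical.choose h else LinearEquiv.refl ℂ _

/-- `E_n(x, y) = (1 / n!) V_k(⟨·, y⟩^n)(x)`, the degree `n` part of the Dunkl kernel. -/
def dunklKernelPart {d : ℕ} (Rpos : Finset (EuclideanSpace ℝ (Fin d)))
    (k : EuclideanSpace ℝ (Fin d) → ℂ) (n : ℕ) (x y : EuclideanSpace ℝ (Fin d)) : ℂ :=
  (1 / (n.factorial : ℂ)) * evalAt x (intertwiner Rpos k (linForm y ^ n))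

/-- `(e^{-Δ/2} f)(y) = ∑_m (-1/2)^m / m! (Δ^m f)(y)`, with the standard Laplacian `Δ`. It is used
for polynomial functions `f` only, where the sum is finite. -/
def expNegHalfLaplacian {d : ℕ} (f : EuclideanSpace ℝ (Fin d) → ℂ)
    (y : EuclideanSpace ℝ (Fin d)) : ℂ :=
  ∑' m : ℕ, ((-1 / 2 : ℂ) ^ m / (m.factorial : ℂ)) *
    ((fun u : EuclideanSpace ℝ (Fin d) → ℂ => Laplacian.laplacian u)^[m] f) y

/-- The `n`-th term `(e^{-Δ/2} E_n(x, ·))(y)` of the series that defines `L_k(x, y)`. -/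
def kernelTerm {d : ℕ} (Rpos : Finset (EuclideanSpace ℝ (Fin d)))
    (k : EuclideanSpace ℝ (Fin d) → ℂ) (x y : EuclideanSpace ℝ (Fin d)) (n : ℕ) : ℂ :=
  expNegHalfLaplacian (dunklKernelPart Rpos k n x) y

/-- The kernel `L_k(x, y) = ∑_n (e^{-Δ/2} E_n(x, ·))(y)`. -/
def kernelL {d : ℕ} (Rpos : Finset (EuclideanSpace ℝ (Fin d)))
    (k : EuclideanSpace ℝ (Fin d) → ℂ) (x y : EuclideanSpace ℝ (Fin d)) : ℂ :=
  ∑' n : ℕ, kernelTerm Rpos k x y n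

end DunklKernel

end

noncomputable section

namespace DunklKernel

open MvPolynomial

variable {d : ℕ}

/-! ### The action of isometries and divided differences -/

/-! Commutativity of the Dunkl operators comes from building polynomials out of `1` by linear forms.
The commutator of `T_ξ` with multiplication by `⟨·, ζ⟩` is a scalar plus a combination of the
reflections `act (refl α)`, and equivariance moves `T_η` past each reflection; what remains is
symmetric in `ξ` and `η` (`dunklOp_comm`).

Commutativity makes the Taylor-type operators `p ↦ ∑_{|ν| = n} x^ν / ν! · (T^ν p)(0)` satisfy `∂_j W
= W T_j` (`pderiv_invIntertwinerPart`). By the Euler identity `∑ xᵢ Tᵢ = (n + γ) - A`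
(`sum_X_mul_dunklOp`), a homogeneous polynomial of positive degree killed by all `Tᵢ` lies in the
kernel of an injective operator. Hence `W` is injective in each degree, so bijective by finite
dimension, and its inverse is `V_k`. The same identity gives a recursion for `V_k` over the degree,
hence uniqueness; conjugating `V_k` by `g ∈ G` then shows that it commutes with `G`.

For convergence, a maximum principle on a ball, which reflections preserve, bounds the inverse of
`(n + γ) - A` by `2 / n` for large `n`; the recursion then shows that `V_k` grows at most
geometrically on monomials. Since `Δ_y ⟨x, y⟩^n = n(n-1) ‖x‖² ⟨x, y⟩^(n-2)` and `V_k` acts in `x`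
only, `L_k` is a double series dominated by a product of two exponential series.

The symmetries hold term by term: `‖x‖²` is invariant under isometries, and `V_k` commutes with `G`
and, because it preserves degree, with `x ↦ -x`. -/

/-- The real points suffice because `ℝ` is an infinite subset of `ℂ`; identities of complex
polynomials can thus be checked on `ℝ^d`. -/
lemma evalAt_ext {p q : MvPolynomial (Fin d) ℂ} (h : ∀ x, evalAt x p = evalAt x q) : p = q := by
  refine MvPolynomial.funext_set (fun _ => Set.range ((↑) : ℝ → ℂ))
    (fun _ => Set.infinite_range_of_injective Complex.ofReal_injective) ?_
  intro x hx
  choose y hy using fun i => hx i (Set.mem_univ i)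
  have := h (WithLp.toLp 2 y)
  simpa [evalAt, hy] using this

lemma evalAt_linForm (x y : EuclideanSpace ℝ (Fin d)) :
    evalAt x (linForm y) = ((inner ℝ x y : ℝ) : ℂ) := by
  simp [evalAt, linForm, PiLp.inner_apply]

lemma linForm_add (y z : EuclideanSpace ℝ (Fin d)) :
    linForm (y + z) = linForm y + linForm z := by
  simp [linForm, add_mul, Finset.sum_add_distrib]

lemma linForm_smul (c : ℝ) (y : EuclideanSpace ℝ (Fin d)) :
    linForm (c • y) = (c : ℂ) • linForm y := by
  simp [linForm, Finset.smul_sum, MvPolynomial.smul_eq_C_mul, mul_assoc]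

lemma linForm_neg (y : EuclideanSpace ℝ (Fin d)) : linForm (-y) = -linForm y := by
  simp [linForm]

lemma linForm_sub (y z : EuclideanSpace ℝ (Fin d)) :
    linForm (y - z) = linForm y - linForm z := by
  rw [sub_eq_add_neg, linForm_add, linForm_neg, sub_eq_add_neg]

lemma linForm_single (i : Fin d) : linForm (EuclideanSpace.single i 1) = X i := by
  simp [linForm, apply_ite, ite_mul]

lemma linForm_ne_zero {α : EuclideanSpace ℝ (Fin d)} (hα : α ≠ 0) : linForm α ≠ 0 := by
  intro h
  have := evalAt_linForm α α
  rw [h, real_inner_self_eq_norm_sq] at this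
  have h0 : (0 : ℝ) = ‖α‖ ^ 2 := by
    rw [← Complex.ofReal_inj, ← this]
    simp [evalAt]
  exact hα (by simpa using h0.symm)

lemma isHomogeneous_linForm (y : EuclideanSpace ℝ (Fin d)) : (linForm y).IsHomogeneous 1 :=
  IsHomogeneous.sum _ _ _ fun i _ => isHomogeneous_C_mul_X _ i

lemma act_act (g h : EuclideanSpace ℝ (Fin d) ≃ₗᵢ[ℝ] EuclideanSpace ℝ (Fin d))
    (p : MvPolynomial (Fin d) ℂ) : act g (act h p) = act (h * g) p :=
  evalAt_ext fun x => by simp only [evalAt_act]; rfl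

lemma act_one (p : MvPolynomial (Fin d) ℂ) : act 1 p = p :=
  evalAt_ext fun x => by simp only [evalAt_act]; rfl

lemma act_linForm (g : EuclideanSpace ℝ (Fin d) ≃ₗᵢ[ℝ] EuclideanSpace ℝ (Fin d))
    (y : EuclideanSpace ℝ (Fin d)) : act g (linForm y) = linForm (g⁻¹ y) :=
  evalAt_ext fun x => by
    rw [evalAt_act, evalAt_linForm, evalAt_linForm, ← g.inner_map_map x (g⁻¹ y)]
    congr 2
    exact (g.apply_symm_apply y).symm

lemma isHomogeneous_act (g : EuclideanSpace ℝ (Fin d) ≃ₗᵢ[ℝ] EuclideanSpace ℝ (Fin d))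
    {n : ℕ} {p : MvPolynomial (Fin d) ℂ} (hp : p.IsHomogeneous n) :
    (act g p).IsHomogeneous n := by
  have := hp.aeval (fun i => ∑ j, C ((g (EuclideanSpace.single j 1) i : ℝ) : ℂ) * X j)
    (n := 1) (fun i => IsHomogeneous.sum _ _ _ fun j _ => isHomogeneous_C_mul_X _ j)
  simpa [act] using this

lemma refl_mul_self (α : EuclideanSpace ℝ (Fin d)) : refl α * refl α = 1 :=
  Submodule.reflection_mul_reflection _

lemma refl_mul (α : EuclideanSpace ℝ (Fin d))
    (g : EuclideanSpace ℝ (Fin d) ≃ₗᵢ[ℝ] EuclideanSpace ℝ (Fin d)) :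
    refl α * g = g * refl (g⁻¹ α) := by
  ext1 x
  have h : g (g⁻¹ α) = α := g.apply_symm_apply α
  have h2 : inner ℝ x (g⁻¹ α) = inner ℝ (g x) α := by
    rw [← g.inner_map_map, h]
  have h3 : ‖g⁻¹ α‖ = ‖α‖ := by rw [← g.norm_map, h]
  change refl α (g x) = g (refl (g⁻¹ α) x)
  rw [refl_apply, refl_apply, map_sub, map_smul, h, h2, h3]

lemma refl_neg (α : EuclideanSpace ℝ (Fin d)) : refl (-α) = refl α := by
  ext1 x
  simp [refl_apply, neg_div]

lemma refl_self (α : EuclideanSpace ℝ (Fin d)) : refl α α = -α := by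
  by_cases h : α = 0
  · simp [h]
  · rw [refl_apply, real_inner_self_eq_norm_sq, mul_div_assoc, div_self (by simpa using h)]
    module

/-- The polynomial ring is a domain, so the chosen quotient is the only one. All rules for `divDiff`
follow by multiplying with `linForm α`. -/
lemma divDiff_eq {α : EuclideanSpace ℝ (Fin d)} (hα : α ≠ 0) {p q : MvPolynomial (Fin d) ℂ}
    (h : linForm α * q = p - act (refl α) p) : divDiff α p = q :=
  mul_left_cancel₀ (linForm_ne_zero hα) ((linForm_mul_divDiff α p).trans h.symm)

lemma divDiff_add {α : EuclideanSpace ℝ (Fin d)} (hα : α ≠ 0) (p q : MvPolynomial (Fin d) ℂ) :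
    divDiff α (p + q) = divDiff α p + divDiff α q :=
  divDiff_eq hα (by rw [mul_add, linForm_mul_divDiff, linForm_mul_divDiff, map_add]; ring)

lemma divDiff_smul {α : EuclideanSpace ℝ (Fin d)} (hα : α ≠ 0) (c : ℂ)
    (p : MvPolynomial (Fin d) ℂ) : divDiff α (c • p) = c • divDiff α p :=
  divDiff_eq hα (by rw [mul_smul_comm, linForm_mul_divDiff, map_smul, smul_sub])

lemma divDiff_one {α : EuclideanSpace ℝ (Fin d)} (hα : α ≠ 0) :
    divDiff α (1 : MvPolynomial (Fin d) ℂ) = 0 :=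
  divDiff_eq hα (by simp)

lemma divDiff_neg {α : EuclideanSpace ℝ (Fin d)} (hα : α ≠ 0) (p : MvPolynomial (Fin d) ℂ) :
    divDiff (-α) p = -divDiff α p :=
  divDiff_eq (neg_ne_zero.2 hα) (by
    rw [linForm_neg, neg_mul_neg, linForm_mul_divDiff, refl_neg])

lemma act_divDiff (g : EuclideanSpace ℝ (Fin d) ≃ₗᵢ[ℝ] EuclideanSpace ℝ (Fin d))
    {α : EuclideanSpace ℝ (Fin d)} (hα : α ≠ 0) (p : MvPolynomial (Fin d) ℂ) :
    act g (divDiff α p) = divDiff (g⁻¹ α) (act g p) := by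
  refine (divDiff_eq (by simpa using hα) ?_).symm
  rw [← act_linForm, ← map_mul, linForm_mul_divDiff, map_sub, act_act, act_act, refl_mul]

lemma divDiff_linForm_mul {α : EuclideanSpace ℝ (Fin d)} (hα : α ≠ 0)
    (η : EuclideanSpace ℝ (Fin d)) (p : MvPolynomial (Fin d) ℂ) :
    divDiff α (linForm η * p) = linForm η * divDiff α p +
      ((2 * inner ℝ η α / ‖α‖ ^ 2 : ℝ) : ℂ) • act (refl α) p := by
  refine divDiff_eq hα ?_
  have h : (refl α)⁻¹ η = refl α η := by
    rw [inv_eq_of_mul_eq_one_left (refl_mul_self α)]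
  rw [map_mul, act_linForm, h, refl_apply, linForm_sub, linForm_smul, mul_add,
    mul_left_comm, linForm_mul_divDiff, mul_smul_comm, sub_mul, smul_mul_assoc]
  ring

-- The product `linForm α * divDiff α p` is homogeneous of degree `n + 1`, so it equals `linForm α`
-- times the degree `n` component of the quotient; cancelling `linForm α` identifies the quotient
-- with that component.
attribute [local instance] MvPolynomial.gradedAlgebra in
lemma isHomogeneous_divDiff {α : EuclideanSpace ℝ (Fin d)} (hα : α ≠ 0) {n : ℕ}
    {p : MvPolynomial (Fin d) ℂ} (hp : p.IsHomogeneous (n + 1)) :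
    (divDiff α p).IsHomogeneous n := by
  have h : (linForm α * divDiff α p).IsHomogeneous (1 + n) := by
    rw [linForm_mul_divDiff, add_comm]
    exact hp.sub (isHomogeneous_act _ hp)
  have h1 := DirectSum.coe_decompose_mul_add_of_left_mem
    (homogeneousSubmodule (Fin d) ℂ) (j := n) (b := divDiff α p) (isHomogeneous_linForm α)
  rw [DirectSum.decompose_of_mem_same _ h] at h1
  rw [mul_left_cancel₀ (linForm_ne_zero hα) h1]
  exact (DirectSum.decompose (homogeneousSubmodule (Fin d) ℂ) (divDiff α p) n).2

/-! ### Dunkl operators -/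

lemma dirDeriv_add (ξ : EuclideanSpace ℝ (Fin d)) (p q : MvPolynomial (Fin d) ℂ) :
    dirDeriv ξ (p + q) = dirDeriv ξ p + dirDeriv ξ q := by
  simp [dirDeriv, Finset.sum_add_distrib]

lemma dirDeriv_smul (ξ : EuclideanSpace ℝ (Fin d)) (c : ℂ) (p : MvPolynomial (Fin d) ℂ) :
    dirDeriv ξ (c • p) = c • dirDeriv ξ p := by
  simp [dirDeriv, Finset.smul_sum, smul_comm c]

lemma dirDeriv_mul (ξ : EuclideanSpace ℝ (Fin d)) (p q : MvPolynomial (Fin d) ℂ) :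
    dirDeriv ξ (p * q) = dirDeriv ξ p * q + p * dirDeriv ξ q := by
  simp only [dirDeriv, Derivation.leibniz, smul_eq_mul, Finset.sum_mul, Finset.mul_sum,
    ← Finset.sum_add_distrib]
  refine Finset.sum_congr rfl fun i _ => ?_
  simp only [MvPolynomial.smul_eq_C_mul]
  ring

lemma dirDeriv_linForm (ξ η : EuclideanSpace ℝ (Fin d)) :
    dirDeriv ξ (linForm η) = C ((inner ℝ ξ η : ℝ) : ℂ) := by
  classical
  simp only [dirDeriv, linForm, map_sum, pderiv_C_mul, pderiv_X, PiLp.inner_apply]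
  simp [Pi.single_apply, MvPolynomial.smul_eq_C_mul, mul_comm]

lemma dirDeriv_one (ξ : EuclideanSpace ℝ (Fin d)) :
    dirDeriv ξ (1 : MvPolynomial (Fin d) ℂ) = 0 := by
  simp [dirDeriv]

lemma isHomogeneous_dirDeriv (ξ : EuclideanSpace ℝ (Fin d)) {n : ℕ}
    {p : MvPolynomial (Fin d) ℂ} (hp : p.IsHomogeneous (n + 1)) :
    (dirDeriv ξ p).IsHomogeneous n :=
  IsHomogeneous.sum _ _ _ fun i _ => by
    rw [MvPolynomial.smul_eq_C_mul]
    exact hp.pderiv.C_mul _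

/-- Linear forms replace the coordinates as generators because isometries permute them. -/
lemma induction_linForm {M : MvPolynomial (Fin d) ℂ → Prop} (one : M 1)
    (add : ∀ p q, M p → M q → M (p + q)) (smul : ∀ (c : ℂ) p, M p → M (c • p))
    (linForm_mul : ∀ η p, M p → M (linForm η * p)) (p : MvPolynomial (Fin d) ℂ) : M p := by
  induction p using MvPolynomial.induction_on with
  | C a => simpa [MvPolynomial.smul_eq_C_mul] using smul a 1 one
  | add p q hp hq => exact add p q hp hq
  | mul_X p i hp => simpa [linForm_single, mul_comm] using linForm_mul (EuclideanSpace.single i 1) p hp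

lemma act_dirDeriv (g : EuclideanSpace ℝ (Fin d) ≃ₗᵢ[ℝ] EuclideanSpace ℝ (Fin d))
    (ξ : EuclideanSpace ℝ (Fin d)) (p : MvPolynomial (Fin d) ℂ) :
    act g (dirDeriv ξ p) = dirDeriv (g⁻¹ ξ) (act g p) := by
  induction p using induction_linForm with
  | one => simp [dirDeriv_one]
  | add p q hp hq => simp only [dirDeriv_add, map_add, hp, hq]
  | smul c p hp => simp only [dirDeriv_smul, map_smul, hp]
  | linForm_mul η p hp =>
    simp only [dirDeriv_mul, map_mul, map_add, hp, act_linForm, dirDeriv_linForm]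
    rw [LinearIsometryEquiv.inner_map_map]
    simp [act]

lemma dirDeriv_add_left (ξ η : EuclideanSpace ℝ (Fin d)) (p : MvPolynomial (Fin d) ℂ) :
    dirDeriv (ξ + η) p = dirDeriv ξ p + dirDeriv η p := by
  simp [dirDeriv, add_smul, Finset.sum_add_distrib]

lemma dirDeriv_smul_left (c : ℝ) (ξ : EuclideanSpace ℝ (Fin d)) (p : MvPolynomial (Fin d) ℂ) :
    dirDeriv (c • ξ) p = (c : ℂ) • dirDeriv ξ p := by
  simp [dirDeriv, Finset.smul_sum, mul_smul]

lemma dirDeriv_single (i : Fin d) (p : MvPolynomial (Fin d) ℂ) :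
    dirDeriv (EuclideanSpace.single i 1) p = pderiv i p := by
  simp [dirDeriv, apply_ite, ite_smul]

section

variable {S : Finset (EuclideanSpace ℝ (Fin d))} {k : EuclideanSpace ℝ (Fin d) → ℂ}

lemma dunklOp_add_left (ξ η : EuclideanSpace ℝ (Fin d)) (p : MvPolynomial (Fin d) ℂ) :
    dunklOp S k (ξ + η) p = dunklOp S k ξ p + dunklOp S k η p := by
  simp only [dunklOp, dirDeriv_add_left, inner_add_right, Complex.ofReal_add, mul_add, add_smul,
    Finset.sum_add_distrib]
  abel

lemma dunklOp_smul_left (c : ℝ) (ξ : EuclideanSpace ℝ (Fin d)) (p : MvPolynomial (Fin d) ℂ) :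
    dunklOp S k (c • ξ) p = (c : ℂ) • dunklOp S k ξ p := by
  simp only [dunklOp, dirDeriv_smul_left, inner_smul_right, Complex.ofReal_mul, mul_left_comm _ (c : ℂ),
    mul_smul, smul_add, Finset.smul_sum]

lemma dunklOp_sub_left (ξ η : EuclideanSpace ℝ (Fin d)) (p : MvPolynomial (Fin d) ℂ) :
    dunklOp S k (ξ - η) p = dunklOp S k ξ p - dunklOp S k η p := by
  rw [sub_eq_add_neg, ← neg_one_smul ℝ η, dunklOp_add_left, dunklOp_smul_left]
  simp [sub_eq_add_neg]

lemma eq_sum_single (ξ : EuclideanSpace ℝ (Fin d)) :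
    ξ = ∑ i, ξ i • EuclideanSpace.single i (1 : ℝ) := by
  ext i
  simp [Finset.sum_apply, Pi.single_apply]

lemma dunklOp_eq_sum (ξ : EuclideanSpace ℝ (Fin d)) (p : MvPolynomial (Fin d) ℂ) :
    dunklOp S k ξ p = ∑ i, (ξ i : ℂ) • dunklOp S k (EuclideanSpace.single i 1) p := by
  have h (s : Finset (Fin d)) :
      dunklOp S k (∑ i ∈ s, ξ i • EuclideanSpace.single i (1 : ℝ)) p =
        ∑ i ∈ s, (ξ i : ℂ) • dunklOp S k (EuclideanSpace.single i 1) p := by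
    classical
    induction s using Finset.induction_on with
    | empty => simp [dunklOp, dirDeriv]
    | insert a s ha ih =>
      rw [Finset.sum_insert ha, Finset.sum_insert ha, dunklOp_add_left, dunklOp_smul_left, ih]
  conv_lhs => rw [eq_sum_single ξ]
  exact h _

variable (hS : ∀ α ∈ S, α ≠ 0)
include hS

lemma dunklOp_add (ξ : EuclideanSpace ℝ (Fin d)) (p q : MvPolynomial (Fin d) ℂ) :
    dunklOp S k ξ (p + q) = dunklOp S k ξ p + dunklOp S k ξ q := by
  simp only [dunklOp, dirDeriv_add]
  rw [add_add_add_comm, ← Finset.sum_add_distrib]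
  congr 1
  exact Finset.sum_congr rfl fun α hα => by rw [divDiff_add (hS α hα), smul_add]

lemma dunklOp_smul (ξ : EuclideanSpace ℝ (Fin d)) (c : ℂ) (p : MvPolynomial (Fin d) ℂ) :
    dunklOp S k ξ (c • p) = c • dunklOp S k ξ p := by
  simp only [dunklOp, dirDeriv_smul, smul_add, Finset.smul_sum]
  congr 1
  exact Finset.sum_congr rfl fun α hα => by rw [divDiff_smul (hS α hα), smul_comm]

lemma dunklOp_one (ξ : EuclideanSpace ℝ (Fin d)) :
    dunklOp S k ξ (1 : MvPolynomial (Fin d) ℂ) = 0 := by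
  rw [dunklOp, dirDeriv_one, zero_add]
  exact Finset.sum_eq_zero fun α hα => by rw [divDiff_one (hS α hα), smul_zero]

lemma dunklOp_sum {ι : Type*} (s : Finset ι) (ξ : EuclideanSpace ℝ (Fin d))
    (f : ι → MvPolynomial (Fin d) ℂ) :
    dunklOp S k ξ (∑ i ∈ s, f i) = ∑ i ∈ s, dunklOp S k ξ (f i) :=
  map_sum (IsLinearMap.mk' (dunklOp S k ξ) ⟨dunklOp_add hS ξ, dunklOp_smul hS ξ⟩) f s

lemma isHomogeneous_dunklOp (ξ : EuclideanSpace ℝ (Fin d)) {n : ℕ}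
    {p : MvPolynomial (Fin d) ℂ} (hp : p.IsHomogeneous (n + 1)) :
    (dunklOp S k ξ p).IsHomogeneous n :=
  (isHomogeneous_dirDeriv ξ hp).add <| IsHomogeneous.sum _ _ _ fun α hα => by
    rw [MvPolynomial.smul_eq_C_mul]
    exact (isHomogeneous_divDiff (hS α hα) hp).C_mul _

lemma dunklOp_linForm_mul (ξ η : EuclideanSpace ℝ (Fin d)) (p : MvPolynomial (Fin d) ℂ) :
    dunklOp S k ξ (linForm η * p) = linForm η * dunklOp S k ξ p +
      (((inner ℝ ξ η : ℝ) : ℂ) • p +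
      ∑ α ∈ S, (k α * ((inner ℝ α ξ : ℝ) : ℂ)) •
        ((2 * inner ℝ η α / ‖α‖ ^ 2 : ℝ) : ℂ) • act (refl α) p) := by
  have h : ∑ α ∈ S, (k α * ((inner ℝ α ξ : ℝ) : ℂ)) • divDiff α (linForm η * p) =
      linForm η * ∑ α ∈ S, (k α * ((inner ℝ α ξ : ℝ) : ℂ)) • divDiff α p +
      ∑ α ∈ S, (k α * ((inner ℝ α ξ : ℝ) : ℂ)) •
        ((2 * inner ℝ η α / ‖α‖ ^ 2 : ℝ) : ℂ) • act (refl α) p := by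
    rw [Finset.mul_sum, ← Finset.sum_add_distrib]
    refine Finset.sum_congr rfl fun α hα => ?_
    rw [divDiff_linForm_mul (hS α hα), smul_add, mul_smul_comm]
  rw [dunklOp, h, dirDeriv_mul, dirDeriv_linForm, dunklOp, MvPolynomial.smul_eq_C_mul]
  ring

omit hS in
/-- The Euler identity `∑ xᵢ Tᵢ = (n + γ) - A` on homogeneous polynomials of degree `n`. -/
lemma sum_X_mul_dunklOp {n : ℕ} {p : MvPolynomial (Fin d) ℂ} (hp : p.IsHomogeneous n) :
    ∑ i, X i * dunklOp S k (EuclideanSpace.single i 1) p = eulerOp S k n p := by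
  have h1 : ∑ i, X i * dirDeriv (EuclideanSpace.single i 1) p = (n : ℂ) • p := by
    simp_rw [dirDeriv_single, hp.sum_X_mul_pderiv, Nat.cast_smul_eq_nsmul]
  have h2 : ∑ i, X i * ∑ α ∈ S, (k α * ((inner ℝ α (EuclideanSpace.single i 1) : ℝ) : ℂ)) •
      divDiff α p = ∑ α ∈ S, k α • (p - act (refl α) p) := by
    simp_rw [Finset.mul_sum]
    rw [Finset.sum_comm]
    refine Finset.sum_congr rfl fun α _ => ?_
    rw [← linForm_mul_divDiff, linForm, Finset.sum_mul, Finset.smul_sum]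
    refine Finset.sum_congr rfl fun i _ => ?_
    simp only [MvPolynomial.smul_eq_C_mul, map_mul, EuclideanSpace.inner_single_right]
    simp
    ring
  simp only [dunklOp, mul_add, Finset.sum_add_distrib, h1, h2, eulerOp, smul_sub, add_smul,
    Finset.sum_sub_distrib, ← Finset.sum_smul]
  ring

end

/-! ### Equivariance and commutativity -/

section

variable {R : Finset (EuclideanSpace ℝ (Fin d))} (hR : IsRootSystem R)
include hR

lemma IsRootSystem.ne_zero {α : EuclideanSpace ℝ (Fin d)} (hα : α ∈ R) : α ≠ 0 :=
  fun h => hR.zero_notMem (h ▸ hα)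

lemma IsRootSystem.neg_mem {α : EuclideanSpace ℝ (Fin d)} (hα : α ∈ R) : -α ∈ R :=
  refl_self α ▸ hR.reflection_mem α hα α hα

lemma IsRootSystem.ne_zero_of_mem_posRoots {β α : EuclideanSpace ℝ (Fin d)}
    (hα : α ∈ posRoots R β) : α ≠ 0 :=
  hR.ne_zero (Finset.mem_filter.1 hα).1

lemma IsRootSystem.apply_mem
    {g : EuclideanSpace ℝ (Fin d) ≃ₗᵢ[ℝ] EuclideanSpace ℝ (Fin d)} (hg : g ∈ reflectionGroup R) :
    ∀ α ∈ R, g α ∈ R := by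
  have hinv : ∀ g : EuclideanSpace ℝ (Fin d) ≃ₗᵢ[ℝ] EuclideanSpace ℝ (Fin d),
      g ∈ refl '' (R : Set (EuclideanSpace ℝ (Fin d))) → g⁻¹ = g := by
    rintro _ ⟨α, _, rfl⟩
    exact inv_eq_of_mul_eq_one_left (refl_mul_self α)
  induction hg using Subgroup.closure_induction'' with
  | one => exact fun α hα => hα
  | mem g hg =>
    obtain ⟨α, hα, rfl⟩ := hg
    exact hR.reflection_mem α hα
  | inv_mem g hg =>
    rw [hinv g hg]
    obtain ⟨α, hα, rfl⟩ := hg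
    exact hR.reflection_mem α hα
  | mul g h _ _ hg hh => exact fun α hα => hg _ (hh α hα)

/-- As no root is orthogonal to `β`, `R` is the disjoint union of `R₊` and `-R₊`. -/
lemma IsRootSystem.sum_eq_two_mul_sum_posRoots {β : EuclideanSpace ℝ (Fin d)}
    (hβ : ∀ α ∈ R, inner ℝ α β ≠ 0) {M : Type*} [AddCommGroup M]
    {f : EuclideanSpace ℝ (Fin d) → M} (hf : ∀ α ∈ R, f (-α) = f α) :
    ∑ α ∈ R, f α = ∑ α ∈ posRoots R β, f α + ∑ α ∈ posRoots R β, f α := by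
  classical
  rw [← Finset.sum_filter_add_sum_filter_not R (fun α => 0 < inner ℝ α β) f]
  refine congrArg₂ (· + ·) ?_ ?_
  · exact Finset.sum_congr (by ext; simp [posRoots]) fun _ _ => rfl
  · refine Finset.sum_nbij' (fun α => -α) (fun α => -α) ?_ ?_ (by simp) (by simp) ?_
    · intro α hα
      rw [Finset.mem_filter] at hα
      have := lt_of_le_of_ne (not_lt.1 hα.2) (hβ α hα.1)
      simpa [posRoots, hR.neg_mem hα.1] using this
    · intro α hα
      rw [posRoots, Finset.mem_filter] at hα
      simpa [hR.neg_mem hα.1] using hα.2.le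
    · intro α hα
      exact (hf α (Finset.mem_filter.1 hα).1).symm

variable {β : EuclideanSpace ℝ (Fin d)} (hβ : ∀ α ∈ R, inner ℝ α β ≠ 0)
  {k : EuclideanSpace ℝ (Fin d) → ℂ} (hk : ∀ g ∈ reflectionGroup R, ∀ α ∈ R, k (g α) = k α)
include hβ hk

omit hR hβ in
lemma apply_neg_of_invariant {α : EuclideanSpace ℝ (Fin d)} (hα : α ∈ R) : k (-α) = k α := by
  rw [← refl_self]
  exact hk _ (Subgroup.subset_closure ⟨α, hα, rfl⟩) _ hα

/-- `R₊` is not stable under `G`, but each summand is even in `α`, so the sum is half of the sum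
over `R`, which `g` permutes. -/
lemma act_dunklOp {g : EuclideanSpace ℝ (Fin d) ≃ₗᵢ[ℝ] EuclideanSpace ℝ (Fin d)}
    (hg : g ∈ reflectionGroup R) (ξ : EuclideanSpace ℝ (Fin d)) (p : MvPolynomial (Fin d) ℂ) :
    act g (dunklOp (posRoots R β) k ξ p) = dunklOp (posRoots R β) k (g⁻¹ ξ) (act g p) := by
  have key (ξ : EuclideanSpace ℝ (Fin d)) (p : MvPolynomial (Fin d) ℂ) :
      ∑ α ∈ posRoots R β, (k α * ((inner ℝ α ξ : ℝ) : ℂ)) • divDiff α p =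
        (2⁻¹ : ℂ) • ∑ α ∈ R, (k α * ((inner ℝ α ξ : ℝ) : ℂ)) • divDiff α p := by
    rw [hR.sum_eq_two_mul_sum_posRoots hβ, ← two_smul ℂ, smul_smul]
    · simp
    · intro α hα
      rw [apply_neg_of_invariant hk hα, divDiff_neg (hR.ne_zero hα)]
      simp
  rw [dunklOp, dunklOp, key, key, map_add, act_dirDeriv, map_smul, map_sum]
  congr 2
  refine Finset.sum_nbij' (fun α => g⁻¹ α) (fun α => g α)
    (hR.apply_mem (inv_mem hg)) (hR.apply_mem hg)
    (fun α _ => g.apply_symm_apply α) (fun α _ => g.symm_apply_apply α) ?_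
  intro α hα
  rw [map_smul, act_divDiff g (hR.ne_zero hα), hk _ (inv_mem hg) α hα,
    LinearIsometryEquiv.inner_map_map]

/-- Dunkl's theorem: the Dunkl operators commute. -/
theorem dunklOp_comm (ξ η : EuclideanSpace ℝ (Fin d)) (p : MvPolynomial (Fin d) ℂ) :
    dunklOp (posRoots R β) k ξ (dunklOp (posRoots R β) k η p) =
      dunklOp (posRoots R β) k η (dunklOp (posRoots R β) k ξ p) := by
  have hS : ∀ α ∈ posRoots R β, α ≠ 0 := fun α => hR.ne_zero_of_mem_posRoots
  have hzero (ξ) : dunklOp (posRoots R β) k ξ 0 = 0 := by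
    simpa using dunklOp_smul (k := k) hS ξ 0 0
  induction p using induction_linForm with
  | one => simp only [dunklOp_one hS, hzero]
  | add p q hp hq => simp only [dunklOp_add hS, hp, hq]
  | smul c p hp => simp only [dunklOp_smul hS, hp]
  | linForm_mul ζ p hp =>
    -- Equivariance gives `T_ξ ∘ act σ_α = act σ_α ∘ T_{σ_α ξ}`, and `σ_α ξ` differs from `ξ` by a
    -- multiple of `α`.
    have hrefl (α) (hα : α ∈ posRoots R β) (ξ : EuclideanSpace ℝ (Fin d)) :
        dunklOp (posRoots R β) k ξ (act (refl α) p) =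
          act (refl α) (dunklOp (posRoots R β) k ξ p) -
            ((2 * inner ℝ ξ α / ‖α‖ ^ 2 : ℝ) : ℂ) • act (refl α) (dunklOp (posRoots R β) k α p) := by
      have hmem : refl α ∈ reflectionGroup R :=
        Subgroup.subset_closure ⟨α, (Finset.mem_filter.1 hα).1, rfl⟩
      have h : (refl α)⁻¹ (refl α ξ) = ξ := (refl α).symm_apply_apply ξ
      rw [← h, ← act_dunklOp hR hβ hk hmem, h, refl_apply, dunklOp_sub_left, dunklOp_smul_left,
        map_sub, map_smul]
    simp only [dunklOp_linForm_mul hS, dunklOp_add hS, dunklOp_smul hS, dunklOp_sum hS, hp]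
    -- These are the reflection terms of `T_ξ T_η (⟨·, ζ⟩ p)`. The right-hand side is visibly
    -- symmetric in `ξ` and `η`.
    have key (ξ η : EuclideanSpace ℝ (Fin d)) :
        ∑ α ∈ posRoots R β, (k α * ((inner ℝ α ξ : ℝ) : ℂ)) •
          ((2 * inner ℝ ζ α / ‖α‖ ^ 2 : ℝ) : ℂ) • act (refl α) (dunklOp (posRoots R β) k η p) +
        ∑ α ∈ posRoots R β, (k α * ((inner ℝ α η : ℝ) : ℂ)) •
          ((2 * inner ℝ ζ α / ‖α‖ ^ 2 : ℝ) : ℂ) • dunklOp (posRoots R β) k ξ (act (refl α) p) =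
        ∑ α ∈ posRoots R β, (k α * ((2 * inner ℝ ζ α / ‖α‖ ^ 2 : ℝ) : ℂ)) •
          (((inner ℝ α ξ : ℝ) : ℂ) • act (refl α) (dunklOp (posRoots R β) k η p) +
           ((inner ℝ α η : ℝ) : ℂ) • act (refl α) (dunklOp (posRoots R β) k ξ p) -
           (((inner ℝ α η : ℝ) : ℂ) * ((inner ℝ α ξ : ℝ) : ℂ) * ((2 / ‖α‖ ^ 2 : ℝ) : ℂ)) •
             act (refl α) (dunklOp (posRoots R β) k α p)) := by
      rw [← Finset.sum_add_distrib]
      refine Finset.sum_congr rfl fun α hα => ?_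
      rw [hrefl α hα, real_inner_comm α ξ]
      simp only [MvPolynomial.smul_eq_C_mul, mul_div_right_comm (2 : ℝ), Complex.ofReal_mul, map_mul]
      ring
    have h := (key ξ η).trans (Eq.trans (Finset.sum_congr rfl fun α _ => ?_) (key η ξ).symm)
    · have aux (a b c s t s' t' : MvPolynomial (Fin d) ℂ) (h : s + t = s' + t') :
          a + (b + s) + (c + t) = a + (c + s') + (b + t') := by
        linear_combination h
      exact aux _ _ _ _ _ _ _ h
    · rw [mul_comm ((inner ℝ α η : ℝ) : ℂ) ((inner ℝ α ξ : ℝ) : ℂ),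
        add_comm (((inner ℝ α ξ : ℝ) : ℂ) • _)]

end

/-! ### The intertwining operator -/

lemma linearMap_ext_isHomogeneous {M : Type*} [AddCommGroup M] [Module ℂ M]
    {f g : MvPolynomial (Fin d) ℂ →ₗ[ℂ] M}
    (h : ∀ n p, p.IsHomogeneous n → f p = g p) : f = g := by
  refine LinearMap.ext fun p => ?_
  rw [← sum_homogeneousComponent p, map_sum, map_sum]
  exact Finset.sum_congr rfl fun n _ => h n _ (homogeneousComponent_isHomogeneous n p)

/-! ### Existence, through the inverse operator -/

section

variable {S : Finset (EuclideanSpace ℝ (Fin d))} (k : EuclideanSpace ℝ (Fin d) → ℂ)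
  (hS : ∀ α ∈ S, α ≠ 0)

/-- The Dunkl operator as a linear map. -/
def dunklLin (ξ : EuclideanSpace ℝ (Fin d)) :
    MvPolynomial (Fin d) ℂ →ₗ[ℂ] MvPolynomial (Fin d) ℂ :=
  IsLinearMap.mk' (dunklOp S k ξ) ⟨dunklOp_add hS ξ, dunklOp_smul hS ξ⟩

/-- The degree `n` part `p ↦ ∑_{|ν| = n} x^ν / ν! · (T^ν p)(0)` of the inverse of the intertwining
operator, defined by recursion through Euler's identity. -/
def invIntertwinerPart : ℕ → (MvPolynomial (Fin d) ℂ →ₗ[ℂ] MvPolynomial (Fin d) ℂ)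
  | 0 => Algebra.linearMap ℂ _ ∘ₗ lcoeff ℂ 0
  | n + 1 => ((n : ℂ) + 1)⁻¹ • ∑ i, LinearMap.mulLeft ℂ (X i) ∘ₗ invIntertwinerPart n ∘ₗ
      dunklLin k hS (EuclideanSpace.single i 1)

lemma invIntertwinerPart_succ (n : ℕ) (p : MvPolynomial (Fin d) ℂ) :
    invIntertwinerPart k hS (n + 1) p = ((n : ℂ) + 1)⁻¹ •
      ∑ i, X i * invIntertwinerPart k hS n (dunklOp S k (EuclideanSpace.single i 1) p) := by
  simp [invIntertwinerPart, LinearMap.sum_apply, dunklLin]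

lemma isHomogeneous_invIntertwinerPart (n : ℕ) (p : MvPolynomial (Fin d) ℂ) :
    (invIntertwinerPart k hS n p).IsHomogeneous n := by
  induction n generalizing p with
  | zero => exact isHomogeneous_C _ _
  | succ n ih =>
    rw [invIntertwinerPart_succ, MvPolynomial.smul_eq_C_mul]
    refine IsHomogeneous.C_mul (IsHomogeneous.sum _ _ _ fun i _ => ?_) _
    rw [add_comm]
    exact (isHomogeneous_X _ i).mul (ih _)

/-- The inverse of the intertwining operator. -/
def invIntertwiner : MvPolynomial (Fin d) ℂ →ₗ[ℂ] MvPolynomial (Fin d) ℂ :=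
  (basisMonomials (Fin d) ℂ).constr ℂ fun s => invIntertwinerPart k hS s.degree (monomial s 1)

lemma invIntertwiner_apply {n : ℕ} {p : MvPolynomial (Fin d) ℂ} (hp : p.IsHomogeneous n) :
    invIntertwiner k hS p = invIntertwinerPart k hS n p := by
  rw [p.as_sum, map_sum, map_sum]
  refine Finset.sum_congr rfl fun s hs => ?_
  have h1 : s.degree = n := by
    by_contra h
    exact mem_support_iff.1 hs (hp.coeff_eq_zero h)
  have h2 : monomial s (coeff s p) = coeff s p • basisMonomials (Fin d) ℂ s := by
    simp [smul_monomial]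
  rw [h2, map_smul, map_smul, invIntertwiner, Module.Basis.constr_basis, h1]
  simp

lemma homogeneousComponent_invIntertwiner (n : ℕ) (p : MvPolynomial (Fin d) ℂ) :
    homogeneousComponent n (invIntertwiner k hS p) =
      invIntertwiner k hS (homogeneousComponent n p) := by
  refine LinearMap.congr_fun (f := homogeneousComponent n ∘ₗ invIntertwiner k hS)
    (g := invIntertwiner k hS ∘ₗ homogeneousComponent n)
    (linearMap_ext_isHomogeneous fun m q hq => ?_) p
  have h : invIntertwiner k hS q ∈ homogeneousSubmodule (Fin d) ℂ m := by
    rw [invIntertwiner_apply k hS hq]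
    exact isHomogeneous_invIntertwinerPart k hS m q
  rw [LinearMap.comp_apply, LinearMap.comp_apply, homogeneousComponent_of_mem h,
    homogeneousComponent_of_mem hq]
  split_ifs <;> simp

variable (hcomm : ∀ ξ η p, dunklOp S k ξ (dunklOp S k η p) = dunklOp S k η (dunklOp S k ξ p))
include hcomm

/-- By the product rule, `∂_j` of `∑ xᵢ W(Tᵢ p)` is `W(T_j p)` plus `∑ xᵢ ∂_j W(Tᵢ p)`. By induction
and commutativity the latter is the recursion for `T_j p`, a multiple of `W(T_j p)`; the
coefficients add up to cancel the normalization. -/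
lemma pderiv_invIntertwinerPart (n : ℕ) (j : Fin d) (p : MvPolynomial (Fin d) ℂ) :
    pderiv j (invIntertwinerPart k hS (n + 1) p) =
      invIntertwinerPart k hS n (dunklOp S k (EuclideanSpace.single j 1) p) := by
  classical
  have hsum (q : Fin d → MvPolynomial (Fin d) ℂ) :
      ∑ i, (X i * pderiv j (q i) + q i * pderiv j (X i)) = ∑ i, X i * pderiv j (q i) + q j := by
    rw [Finset.sum_add_distrib]
    simp [pderiv_X, Pi.single_apply]
  induction n generalizing p with
  | zero =>
    rw [invIntertwinerPart_succ]
    rw [Derivation.map_smul, map_sum]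
    simp only [Derivation.leibniz, smul_eq_mul, hsum]
    simp [invIntertwinerPart]
  | succ n ih =>
    rw [invIntertwinerPart_succ]
    rw [Derivation.map_smul, map_sum]
    simp only [Derivation.leibniz, smul_eq_mul]
    rw [hsum]
    simp only [ih, hcomm (EuclideanSpace.single j 1)]
    have h0 : ((n : ℂ) + 1) ≠ 0 := by exact_mod_cast n.succ_ne_zero
    have h1 : ((n : ℂ) + 1 + 1) ≠ 0 := by exact_mod_cast (n + 1).succ_ne_zero
    have h := invIntertwinerPart_succ k hS n (dunklOp S k (EuclideanSpace.single j 1) p)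
    rw [eq_comm, inv_smul_eq_iff₀ h0] at h
    push_cast
    rw [h, inv_smul_eq_iff₀ h1, add_smul, add_smul, one_smul]
    simp only [add_smul, one_smul]

variable (hM : IsInvertibleParam S k)
include hM

/-- Differentiating shows that every `Tᵢ p` is in the kernel one degree lower, hence zero; then
`eulerOp` kills `p` by the Euler identity. -/
lemma eq_zero_of_invIntertwinerPart_eq_zero {n : ℕ} {p : MvPolynomial (Fin d) ℂ}
    (hp : p.IsHomogeneous n) (h : invIntertwinerPart k hS n p = 0) : p = 0 := by
  induction n generalizing p with
  | zero =>
    rw [← homogeneousComponent_eq_self hp, homogeneousComponent_zero]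
    simpa [invIntertwinerPart] using h
  | succ n ih =>
    refine (hM (n + 1) n.succ_pos).injOn hp (Submodule.zero_mem _) ?_
    rw [← sum_X_mul_dunklOp hp, ← sum_X_mul_dunklOp (isHomogeneous_zero _ _ _)]
    refine Finset.sum_congr rfl fun i _ => ?_
    rw [ih (isHomogeneous_dunklOp hS _ hp)
      (by rw [← pderiv_invIntertwinerPart k hS hcomm, h, map_zero])]
    exact congrArg _ (map_zero (dunklLin k hS _)).symm

lemma exists_invIntertwinerPart_eq {n : ℕ} {p : MvPolynomial (Fin d) ℂ}
    (hp : p.IsHomogeneous n) : ∃ q, q.IsHomogeneous n ∧ invIntertwinerPart k hS n q = p := by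
  let f : homogeneousSubmodule (Fin d) ℂ n →ₗ[ℂ] homogeneousSubmodule (Fin d) ℂ n :=
    (invIntertwinerPart k hS n).restrict fun q _ => isHomogeneous_invIntertwinerPart k hS n q
  have : FiniteDimensional ℂ (homogeneousSubmodule (Fin d) ℂ n) :=
    Module.Finite.iff_fg.2 (homogeneousSubmodule_fg _ _ n)
  have hinj : Function.Injective f := by
    rw [injective_iff_map_eq_zero]
    intro q hq
    exact Subtype.ext (eq_zero_of_invIntertwinerPart_eq_zero k hS hcomm hM q.2
      (congrArg Subtype.val hq))
  obtain ⟨q, hq⟩ := LinearMap.injective_iff_surjective.1 hinj ⟨p, hp⟩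
  exact ⟨q, q.2, congrArg Subtype.val hq⟩

lemma bijective_invIntertwiner : Function.Bijective (invIntertwiner k hS) := by
  constructor
  · rw [injective_iff_map_eq_zero]
    intro p hp
    rw [← sum_homogeneousComponent p]
    refine Finset.sum_eq_zero fun n _ => ?_
    have hn := homogeneousComponent_isHomogeneous n p
    refine eq_zero_of_invIntertwinerPart_eq_zero k hS hcomm hM hn ?_
    rw [← invIntertwiner_apply k hS hn, ← homogeneousComponent_invIntertwiner, hp, map_zero]
  · intro p
    rw [← LinearMap.mem_range, ← sum_homogeneousComponent p]
    refine Submodule.sum_mem _ fun n _ => ?_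
    obtain ⟨q, hq, h⟩ := exists_invIntertwinerPart_eq k hS hcomm hM
      (homogeneousComponent_isHomogeneous n p)
    exact ⟨q, (invIntertwiner_apply k hS hq).trans h⟩

omit hM in
lemma invIntertwiner_dunklOp (ξ : EuclideanSpace ℝ (Fin d)) (p : MvPolynomial (Fin d) ℂ) :
    invIntertwiner k hS (dunklOp S k ξ p) = dirDeriv ξ (invIntertwiner k hS p) := by
  have hj (j : Fin d) : invIntertwiner k hS ∘ₗ dunklLin k hS (EuclideanSpace.single j 1) =
      (pderiv j).toLinearMap ∘ₗ invIntertwiner k hS := by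
    refine linearMap_ext_isHomogeneous fun n q hq => ?_
    change invIntertwiner k hS (dunklOp S k _ q) = pderiv j (invIntertwiner k hS q)
    rw [invIntertwiner_apply k hS hq]
    cases n with
    | zero =>
      have h1 : q = coeff 0 q • 1 := by
        conv_lhs => rw [← homogeneousComponent_eq_self hq, homogeneousComponent_zero]
        rw [MvPolynomial.smul_eq_C_mul, mul_one]
      rw [h1, dunklOp_smul hS, dunklOp_one hS]
      simp [invIntertwinerPart]
    | succ n =>
      rw [pderiv_invIntertwinerPart k hS hcomm,
        invIntertwiner_apply k hS (isHomogeneous_dunklOp hS _ hq)]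
  rw [dunklOp_eq_sum, map_sum, dirDeriv]
  refine Finset.sum_congr rfl fun j _ => ?_
  rw [map_smul]
  exact congrArg _ (LinearMap.congr_fun (hj j) p)

include hS in
theorem exists_isIntertwining : ∃ V, IsIntertwining S k V := by
  let e := LinearEquiv.ofBijective _ (bijective_invIntertwiner k hS hcomm hM)
  have he (p) : e p = invIntertwiner k hS p := rfl
  refine ⟨e.symm, fun n p hp => ?_, ?_, fun ξ p => ?_⟩
  · obtain ⟨q, hq, h⟩ := exists_invIntertwinerPart_eq k hS hcomm hM hp
    have : e.symm p = q := by
      rw [LinearEquiv.symm_apply_eq, he, invIntertwiner_apply k hS hq, h]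
    rwa [this]
  · rw [LinearEquiv.symm_apply_eq, he, invIntertwiner_apply k hS (isHomogeneous_one _ _)]
    simp [invIntertwinerPart]
  · rw [LinearEquiv.eq_symm_apply, he, invIntertwiner_dunklOp k hS hcomm, ← he,
      LinearEquiv.apply_symm_apply]

end

/-! ### Uniqueness, through the Euler recursion -/

variable {S : Finset (EuclideanSpace ℝ (Fin d))} {k : EuclideanSpace ℝ (Fin d) → ℂ}

/-- The recursion that determines an intertwining operator. -/
lemma IsIntertwining.eulerOp_apply {V : MvPolynomial (Fin d) ℂ ≃ₗ[ℂ] MvPolynomial (Fin d) ℂ}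
    (hV : IsIntertwining S k V) {n : ℕ} {p : MvPolynomial (Fin d) ℂ} (hp : p.IsHomogeneous n) :
    eulerOp S k n (V p) = ∑ i, X i * V (pderiv i p) := by
  rw [← sum_X_mul_dunklOp (hV.homogeneous n p hp)]
  simp_rw [hV.intertwines, dirDeriv_single]

theorem IsIntertwining.unique (hM : IsInvertibleParam S k)
    {V W : MvPolynomial (Fin d) ℂ ≃ₗ[ℂ] MvPolynomial (Fin d) ℂ}
    (hV : IsIntertwining S k V) (hW : IsIntertwining S k W) : V = W := by
  refine LinearEquiv.toLinearMap_injective (linearMap_ext_isHomogeneous fun n p hp => ?_)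
  change V p = W p
  induction n generalizing p with
  | zero =>
    have h1 : p = coeff 0 p • 1 := by
      conv_lhs => rw [← homogeneousComponent_eq_self hp, homogeneousComponent_zero]
      rw [MvPolynomial.smul_eq_C_mul, mul_one]
    rw [h1, map_smul, map_smul, hV.map_one, hW.map_one]
  | succ n ih =>
    refine (hM (n + 1) n.succ_pos).injOn (hV.homogeneous _ _ hp) (hW.homogeneous _ _ hp) ?_
    rw [hV.eulerOp_apply hp, hW.eulerOp_apply hp]
    exact Finset.sum_congr rfl fun i _ => by rw [ih _ hp.pderiv]

lemma isIntertwining_intertwiner (h : ∃ V, IsIntertwining S k V) :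
    IsIntertwining S k (intertwiner S k) := by
  rw [intertwiner, dif_pos h]
  exact Classical.choose_spec h

/-! ### Equivariance of the intertwining operator -/

/-- `act g` as a linear equivalence. -/
def actEquiv (g : EuclideanSpace ℝ (Fin d) ≃ₗᵢ[ℝ] EuclideanSpace ℝ (Fin d)) :
    MvPolynomial (Fin d) ℂ ≃ₗ[ℂ] MvPolynomial (Fin d) ℂ :=
  LinearEquiv.ofLinearMap (act g).toLinearMap (act g⁻¹).toLinearMap
    (LinearMap.ext fun p => by simp [act_act, act_one])
    (LinearMap.ext fun p => by simp [act_act, act_one])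

lemma actEquiv_apply (g : EuclideanSpace ℝ (Fin d) ≃ₗᵢ[ℝ] EuclideanSpace ℝ (Fin d))
    (p : MvPolynomial (Fin d) ℂ) : actEquiv g p = act g p := rfl

lemma actEquiv_symm_apply (g : EuclideanSpace ℝ (Fin d) ≃ₗᵢ[ℝ] EuclideanSpace ℝ (Fin d))
    (p : MvPolynomial (Fin d) ℂ) : (actEquiv g).symm p = act g⁻¹ p := rfl

/-- The conjugate of `V` by `act g` is again intertwining, since both `∂` and `T` are equivariant;
uniqueness identifies it with `V`. -/
lemma IsIntertwining.act_comm {R : Finset (EuclideanSpace ℝ (Fin d))} (hR : IsRootSystem R)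
    {β : EuclideanSpace ℝ (Fin d)} (hβ : ∀ α ∈ R, inner ℝ α β ≠ 0)
    {k : EuclideanSpace ℝ (Fin d) → ℂ} (hk : ∀ g ∈ reflectionGroup R, ∀ α ∈ R, k (g α) = k α)
    (hM : IsInvertibleParam (posRoots R β) k)
    {V : MvPolynomial (Fin d) ℂ ≃ₗ[ℂ] MvPolynomial (Fin d) ℂ}
    (hV : IsIntertwining (posRoots R β) k V)
    {g : EuclideanSpace ℝ (Fin d) ≃ₗᵢ[ℝ] EuclideanSpace ℝ (Fin d)} (hg : g ∈ reflectionGroup R)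
    (p : MvPolynomial (Fin d) ℂ) : act g (V p) = V (act g p) := by
  have hW : IsIntertwining (posRoots R β) k
      ((actEquiv g).symm.trans (V.trans (actEquiv g))) := by
    refine ⟨fun n p hp => ?_, ?_, fun ξ p => ?_⟩
    · exact isHomogeneous_act g (hV.homogeneous n _ (isHomogeneous_act g⁻¹ hp))
    · simp [actEquiv_apply, actEquiv_symm_apply, hV.map_one]
    · have h : g⁻¹ (g ξ) = ξ := g.symm_apply_apply ξ
      simp only [LinearEquiv.trans_apply, actEquiv_apply, actEquiv_symm_apply, act_dirDeriv,
        inv_inv]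
      rw [← hV.intertwines, act_dunklOp hR hβ hk hg, h]
  have h := LinearEquiv.congr_fun (hW.unique hM hV) (act g p)
  simpa [actEquiv_apply, actEquiv_symm_apply, act_act, act_one] using h

/-- Since `-1` need not lie in `G`, equivariance does not cover it; this scalar action on each
degree does. -/
lemma act_neg {n : ℕ} {p : MvPolynomial (Fin d) ℂ} (hp : p.IsHomogeneous n) :
    act (LinearIsometryEquiv.neg ℝ) p = (-1 : ℂ) ^ n • p := by
  have hX (i : Fin d) : act (LinearIsometryEquiv.neg ℝ) (X i) = (-1 : ℂ) • X i := by
    have h : (LinearIsometryEquiv.neg ℝ (E := EuclideanSpace ℝ (Fin d)))⁻¹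
        (EuclideanSpace.single i 1) = -EuclideanSpace.single i 1 := rfl
    rw [← linForm_single, act_linForm, h, linForm_neg, neg_one_smul]
  conv_lhs => rw [p.as_sum]
  conv_rhs => rw [p.as_sum]
  rw [map_sum, Finset.smul_sum]
  refine Finset.sum_congr rfl fun s hs => ?_
  have hs' : s.degree = n := by
    by_contra h
    exact mem_support_iff.1 hs (hp.coeff_eq_zero h)
  rw [monomial_eq, map_mul, Finsupp.prod, map_prod]
  simp_rw [map_pow, hX, smul_pow]
  rw [Finset.prod_smul, Finset.prod_pow_eq_pow_sum, mul_smul_comm, ← hs']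
  rw [Finsupp.degree_apply]
  simp [act]

/-! ### The Laplacian -/

/-- The polynomial `‖x‖²`. -/
def normSqPoly (d : ℕ) : MvPolynomial (Fin d) ℂ := ∑ i, X i ^ 2

lemma evalAt_normSqPoly (x : EuclideanSpace ℝ (Fin d)) :
    evalAt x (normSqPoly d) = ((‖x‖ ^ 2 : ℝ) : ℂ) := by
  simp [evalAt, normSqPoly, EuclideanSpace.norm_sq_eq]

lemma act_normSqPoly (g : EuclideanSpace ℝ (Fin d) ≃ₗᵢ[ℝ] EuclideanSpace ℝ (Fin d)) :
    act g (normSqPoly d) = normSqPoly d :=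
  evalAt_ext fun x => by rw [evalAt_act, evalAt_normSqPoly, evalAt_normSqPoly, g.norm_map]

/-- The `i`-th coordinate as a complex-valued real-linear functional. -/
def coordCLM (i : Fin d) : EuclideanSpace ℝ (Fin d) →L[ℝ] ℂ :=
  Complex.ofRealCLM ∘L EuclideanSpace.proj i

lemma coordCLM_apply (i : Fin d) (y : EuclideanSpace ℝ (Fin d)) : coordCLM i y = (y i : ℂ) := rfl

lemma map_linForm_mul (φ : MvPolynomial (Fin d) ℂ →ₗ[ℂ] ℂ) (y : EuclideanSpace ℝ (Fin d))
    (p : MvPolynomial (Fin d) ℂ) : φ (linForm y * p) = ∑ i, (y i : ℂ) * φ (X i * p) := by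
  simp only [linForm, Finset.sum_mul, map_sum, ← MvPolynomial.smul_eq_C_mul, smul_mul_assoc,
    map_smul, smul_eq_mul]

/-- An arbitrary functional `φ` makes induction possible: a factor `X i` is absorbed into `φ`. In
the application `φ` is a multiple of `p ↦ V_k p (x)`. For `l = 0` the truncated exponent is
harmless, as its coefficient vanishes. -/
lemma hasFDerivAt_linForm_pow (φ : MvPolynomial (Fin d) ℂ →ₗ[ℂ] ℂ) (l : ℕ)
    (y : EuclideanSpace ℝ (Fin d)) :
    HasFDerivAt (fun y => φ (linForm y ^ l))
      (∑ i, ((l : ℂ) * φ (X i * linForm y ^ (l - 1))) • coordCLM i) y := by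
  induction l generalizing φ with
  | zero =>
    have h : ∑ i, (((0 : ℕ) : ℂ) * φ (X i * linForm y ^ (0 - 1))) • coordCLM i = 0 :=
      Finset.sum_eq_zero fun i _ => ContinuousLinearMap.ext fun v => by simp
    rw [h]
    simpa using hasFDerivAt_const (𝕜 := ℝ) (φ 1) y
  | succ l ih =>
    have h : (fun y : EuclideanSpace ℝ (Fin d) => φ (linForm y ^ (l + 1))) =
        fun y => ∑ i, coordCLM i y * (φ ∘ₗ LinearMap.mulLeft ℂ (X i)) (linForm y ^ l) := by
      ext y
      rw [pow_succ', map_linForm_mul]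
      rfl
    rw [h]
    refine (HasFDerivAt.fun_sum fun (i : Fin d) _ =>
      (coordCLM i).hasFDerivAt.mul (ih (φ ∘ₗ LinearMap.mulLeft ℂ (X i)))).congr_fderiv ?_
    rw [Finset.sum_add_distrib]
    have h1 : ∑ i, coordCLM i y • ∑ j, ((l : ℂ) * (φ ∘ₗ LinearMap.mulLeft ℂ (X i))
        (X j * linForm y ^ (l - 1))) • coordCLM j =
        ∑ j, ((l : ℂ) * φ (X j * linForm y ^ l)) • coordCLM j := by
      simp_rw [Finset.smul_sum]
      rw [Finset.sum_comm]
      refine Finset.sum_congr rfl fun j _ => ?_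
      simp_rw [smul_smul]
      rw [← Finset.sum_smul]
      congr 1
      cases l with
      | zero => simp
      | succ l =>
        rw [pow_succ', mul_left_comm (X j), map_linForm_mul, Finset.mul_sum]
        refine Finset.sum_congr rfl fun i _ => ?_
        rw [LinearMap.comp_apply, LinearMap.mulLeft_apply, coordCLM_apply, Nat.add_sub_cancel]
        ring
    rw [h1, ← Finset.sum_add_distrib]
    refine Finset.sum_congr rfl fun j _ => ?_
    rw [← add_smul, LinearMap.comp_apply, LinearMap.mulLeft_apply, Nat.add_sub_cancel]
    push_cast
    ring_nf

lemma laplacian_linForm_pow (φ : MvPolynomial (Fin d) ℂ →ₗ[ℂ] ℂ) (l : ℕ) :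
    Laplacian.laplacian (fun y : EuclideanSpace ℝ (Fin d) => φ (linForm y ^ l)) =
      fun y => ((l : ℂ) * (l - 1 : ℕ)) * φ (normSqPoly d * linForm y ^ (l - 2)) := by
  have h1 : fderiv ℝ (fun y : EuclideanSpace ℝ (Fin d) => φ (linForm y ^ l)) =
      fun y => ∑ i, (((l : ℂ) • φ ∘ₗ LinearMap.mulLeft ℂ (X i)) (linForm y ^ (l - 1))) •
        coordCLM i := by
    ext1 y
    exact (hasFDerivAt_linForm_pow φ l y).fderiv
  rw [InnerProductSpace.laplacian_eq_iteratedFDeriv_orthonormalBasis _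
    (EuclideanSpace.basisFun (Fin d) ℝ)]
  ext1 y
  simp only [iteratedFDeriv_two_apply, h1]
  rw [(HasFDerivAt.fun_sum fun i _ => (hasFDerivAt_linForm_pow
    ((l : ℂ) • φ ∘ₗ LinearMap.mulLeft ℂ (X i)) (l - 1) y).smul_const (coordCLM i)).fderiv]
  rw [normSqPoly, Finset.sum_mul, map_sum, Finset.mul_sum]
  refine Finset.sum_congr rfl fun j _ => ?_
  simp [coordCLM_apply, apply_ite]
  rw [Nat.sub_sub, pow_two, mul_assoc (X j)]
  ring

lemma iterate_laplacian_linForm_pow (φ : MvPolynomial (Fin d) ℂ →ₗ[ℂ] ℂ) (l m : ℕ) :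
    (fun u : EuclideanSpace ℝ (Fin d) → ℂ => Laplacian.laplacian u)^[m]
      (fun y => φ (linForm y ^ l)) =
      fun y => (l.descFactorial (2 * m) : ℂ) * φ (normSqPoly d ^ m * linForm y ^ (l - 2 * m)) := by
  induction m with
  | zero => simp
  | succ m ih =>
    rw [Function.iterate_succ_apply', ih]
    have h := laplacian_linForm_pow
      ((l.descFactorial (2 * m) : ℂ) • φ ∘ₗ LinearMap.mulLeft ℂ (normSqPoly d ^ m)) (l - 2 * m)
    refine h.trans (funext fun y => ?_)
    rw [show 2 * (m + 1) = 2 * m + 1 + 1 by ring, Nat.descFactorial_succ, Nat.descFactorial_succ,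
      show l - (2 * m + 1 + 1) = l - 2 * m - 2 by omega,
      show l - (2 * m + 1) = l - 2 * m - 1 by omega, pow_succ, mul_assoc (normSqPoly d ^ m)]
    simp only [LinearMap.smul_apply, LinearMap.comp_apply, LinearMap.mulLeft_apply, smul_eq_mul]
    push_cast
    ring

/-! ### Growth of the intertwining operator -/

lemma evalAt_add (x : EuclideanSpace ℝ (Fin d)) (p q : MvPolynomial (Fin d) ℂ) :
    evalAt x (p + q) = evalAt x p + evalAt x q := by simp [evalAt]

lemma evalAt_smul (x : EuclideanSpace ℝ (Fin d)) (c : ℂ) (p : MvPolynomial (Fin d) ℂ) :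
    evalAt x (c • p) = c * evalAt x p := by simp [evalAt]

/-- Evaluation at a point as a linear map. -/
def evalAtLin (x : EuclideanSpace ℝ (Fin d)) : MvPolynomial (Fin d) ℂ →ₗ[ℂ] ℂ :=
  IsLinearMap.mk' (evalAt x) ⟨evalAt_add x, evalAt_smul x⟩

lemma evalAt_sum {ι : Type*} (s : Finset ι) (x : EuclideanSpace ℝ (Fin d))
    (f : ι → MvPolynomial (Fin d) ℂ) : evalAt x (∑ i ∈ s, f i) = ∑ i ∈ s, evalAt x (f i) :=
  map_sum (evalAtLin x) f s

lemma continuous_evalAt (p : MvPolynomial (Fin d) ℂ) : Continuous fun x => evalAt x p := by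
  unfold evalAt
  exact (MvPolynomial.continuous_eval p).comp (by fun_prop)

lemma exists_norm_evalAt_le (p : MvPolynomial (Fin d) ℂ) (r : ℝ) :
    ∃ B, ∀ x : EuclideanSpace ℝ (Fin d), ‖x‖ ≤ r → ‖evalAt x p‖ ≤ B := by
  obtain ⟨B, hB⟩ := (isCompact_closedBall (0 : EuclideanSpace ℝ (Fin d)) r).exists_bound_of_continuousOn
    (continuous_evalAt p).continuousOn
  exact ⟨B, fun x hx => hB x (by simpa using hx)⟩

/-- The maximum principle for `eulerOp`. -/
lemma norm_evalAt_le_of_eulerOp {n : ℕ} (hn : 1 ≤ n)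
    (hc : 2 * (‖∑ α ∈ S, k α‖ + ∑ α ∈ S, ‖k α‖) ≤ n) {p : MvPolynomial (Fin d) ℂ} {r M : ℝ}
    (hM : ∀ x, ‖x‖ ≤ r → ‖evalAt x (eulerOp S k n p)‖ ≤ M) {x : EuclideanSpace ℝ (Fin d)}
    (hx : ‖x‖ ≤ r) : ‖evalAt x p‖ ≤ 2 * M / n := by
  -- At a maximum point of `|p|` on the ball, all reflected values are at most `|p(x₀)|`, so by `hc`
  -- the terms with `k` absorb at most half of `n |p(x₀)|`.
  obtain ⟨x₀, hx₀, hmax⟩ := (isCompact_closedBall (0 : EuclideanSpace ℝ (Fin d)) r).exists_isMaxOn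
    ⟨x, by simpa using hx⟩ (continuous_evalAt p).norm.continuousOn
  rw [mem_closedBall_zero_iff] at hx₀
  have hle (y : EuclideanSpace ℝ (Fin d)) (hy : ‖y‖ ≤ r) : ‖evalAt y p‖ ≤ ‖evalAt x₀ p‖ :=
    hmax (by simpa using hy)
  have hn0 : (0 : ℝ) < n := by exact_mod_cast hn
  refine (hle x hx).trans ?_
  have h1 : (n : ℂ) * evalAt x₀ p = evalAt x₀ (eulerOp S k n p) -
      (∑ α ∈ S, k α) * evalAt x₀ p + ∑ α ∈ S, k α * evalAt (refl α x₀) p := by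
    have h : evalAt x₀ (eulerOp S k n p) = ((n : ℂ) + ∑ α ∈ S, k α) * evalAt x₀ p -
        ∑ α ∈ S, k α * evalAt (refl α x₀) p := by
      rw [eulerOp, sub_eq_add_neg, ← neg_one_smul ℂ, evalAt_add, evalAt_smul, evalAt_smul,
        evalAt_sum]
      simp_rw [evalAt_smul, evalAt_act]
      ring
    rw [h]
    ring
  have h2 : ‖∑ α ∈ S, k α * evalAt (refl α x₀) p‖ ≤ (∑ α ∈ S, ‖k α‖) * ‖evalAt x₀ p‖ := by
    rw [Finset.sum_mul]
    refine norm_sum_le_of_le _ fun α _ => ?_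
    rw [norm_mul]
    exact mul_le_mul_of_nonneg_left (hle _ (by rwa [LinearIsometryEquiv.norm_map]))
      (norm_nonneg _)
  have h3 := norm_add_le (evalAt x₀ (eulerOp S k n p) - (∑ α ∈ S, k α) * evalAt x₀ p)
    (∑ α ∈ S, k α * evalAt (refl α x₀) p)
  have h4 := norm_sub_le (evalAt x₀ (eulerOp S k n p)) ((∑ α ∈ S, k α) * evalAt x₀ p)
  rw [← h1, norm_mul, Complex.norm_natCast] at h3
  rw [norm_mul] at h4
  have h5 := mul_le_mul_of_nonneg_right hc (norm_nonneg (evalAt x₀ p))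
  rw [le_div_iff₀ hn0]
  linarith [hM x₀ hx₀]

lemma exists_norm_evalAt_monomial_le (V : MvPolynomial (Fin d) ℂ ≃ₗ[ℂ] MvPolynomial (Fin d) ℂ)
    (N : ℕ) (r : ℝ) : ∃ C, 0 ≤ C ∧ ∀ s : Fin d →₀ ℕ, s.degree ≤ N →
      ∀ x : EuclideanSpace ℝ (Fin d), ‖x‖ ≤ r → ‖evalAt x (V (monomial s 1))‖ ≤ C := by
  choose B hB using fun s : Fin d →₀ ℕ => exists_norm_evalAt_le (V (monomial s 1)) r
  obtain ⟨C, hC⟩ := ((Finsupp.finite_of_degree_le (σ := Fin d) N).image B).bddAbove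
  exact ⟨max C 0, le_max_right _ _, fun s hs x hx =>
    (hB s x hx).trans ((hC ⟨s, hs, rfl⟩).trans (le_max_left _ _))⟩

/-- The intertwining operator grows at most exponentially with the degree. -/
theorem IsIntertwining.exists_norm_evalAt_le
    {V : MvPolynomial (Fin d) ℂ ≃ₗ[ℂ] MvPolynomial (Fin d) ℂ}
    (hV : IsIntertwining S k V) {r : ℝ} (hr : 0 ≤ r) : ∃ C, 0 ≤ C ∧ ∀ s : Fin d →₀ ℕ,
      ∀ x : EuclideanSpace ℝ (Fin d), ‖x‖ ≤ r →
        ‖evalAt x (V (monomial s 1))‖ ≤ C * (2 * r + 1) ^ s.degree := by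
  -- Above degree `N` the maximum principle applies; below it there are only finitely many
  -- monomials. In the rate `2 * r + 1`, the `2 * r` is the gain per degree and the `1` keeps the
  -- base at least `1`.
  obtain ⟨N, hN⟩ := exists_nat_ge (2 * (‖∑ α ∈ S, k α‖ + ∑ α ∈ S, ‖k α‖))
  obtain ⟨C, hC0, hC⟩ := exists_norm_evalAt_monomial_le V N r
  refine ⟨C, hC0, fun s x hx => ?_⟩
  induction hn : s.degree generalizing s x with
  | zero => simpa using hC s (by omega) x hx
  | succ n ih =>
    by_cases hsN : s.degree ≤ N
    · exact (hC s hsN x hx).trans (le_mul_of_one_le_right hC0 (one_le_pow₀ (by linarith)))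
    have hn0 : (0 : ℝ) < (n + 1 : ℕ) := by exact_mod_cast n.succ_pos
    have : 0 ≤ C * (2 * r + 1) ^ n := by positivity
    have hE (y : EuclideanSpace ℝ (Fin d)) (hy : ‖y‖ ≤ r) :
        ‖evalAt y (eulerOp S k (n + 1) (V (monomial s 1)))‖ ≤
          (n + 1 : ℕ) * (r * (C * (2 * r + 1) ^ n)) := by
      rw [hV.eulerOp_apply (isHomogeneous_monomial 1 hn), evalAt_sum, ← hn,
        Finsupp.degree_eq_sum, Nat.cast_sum, Finset.sum_mul]
      refine norm_sum_le_of_le _ fun i _ => ?_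
      have h1 : evalAt y (X i * V (pderiv i (monomial s 1))) =
          (y i : ℂ) * ((s i : ℂ) * evalAt y (V (monomial (s - Finsupp.single i 1) 1))) := by
        have h2 : monomial (s - Finsupp.single i 1) (s i : ℂ) =
            (s i : ℂ) • monomial (s - Finsupp.single i 1) 1 := by
          rw [smul_monomial, smul_eq_mul, mul_one]
        rw [pderiv_monomial, one_mul, h2, map_smul, ← evalAt_smul]
        simp [evalAt, mul_left_comm]
      have h2 : ‖(y i : ℂ)‖ ≤ r := by
        rw [Complex.norm_real]
        exact (PiLp.norm_apply_le y i).trans hy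
      rw [h1, norm_mul, norm_mul, Complex.norm_natCast]
      -- If `s i = 0`, truncated subtraction does not lower the degree, but the coefficient is zero.
      rcases Nat.eq_zero_or_pos (s i) with h0 | h0
      · simp [h0]
      have h3 : (s - Finsupp.single i 1).degree = n := by
        have h : s - Finsupp.single i 1 + Finsupp.single i 1 = s :=
          tsub_add_cancel_of_le (Finsupp.single_le_iff.2 h0)
        have := congrArg Finsupp.degree h
        rw [map_add, Finsupp.degree_single, hn] at this
        omega
      calc ‖(y i : ℂ)‖ * (s i * ‖evalAt y (V (monomial (s - Finsupp.single i 1) 1))‖)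
          ≤ r * (s i * (C * (2 * r + 1) ^ n)) := by
            gcongr
            exact ih _ y hy h3
        _ = s i * (r * (C * (2 * r + 1) ^ n)) := by ring
    have hc : 2 * (‖∑ α ∈ S, k α‖ + ∑ α ∈ S, ‖k α‖) ≤ ((n + 1 : ℕ) : ℝ) :=
      hN.trans (by exact_mod_cast (by omega))
    refine (norm_evalAt_le_of_eulerOp n.succ_pos hc hE hx).trans ?_
    rw [mul_left_comm, mul_div_cancel_left₀ _ hn0.ne', pow_succ]
    linarith

/-- Multiplication by a variable preserves the type of bound, at the cost of a factor `D` in the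
constant; this drives the next two inductions over `φ` and `C`. -/
lemma norm_map_X_mul_monomial_le {φ : MvPolynomial (Fin d) ℂ →ₗ[ℂ] ℂ} {C D : ℝ}
    (hφ : ∀ s, ‖φ (monomial s 1)‖ ≤ C * D ^ s.degree) (i : Fin d) (s : Fin d →₀ ℕ) :
    ‖(φ ∘ₗ LinearMap.mulLeft ℂ (X i)) (monomial s 1)‖ ≤ (C * D) * D ^ s.degree := by
  have h : X i * monomial s (1 : ℂ) = monomial (Finsupp.single i 1 + s) 1 := by
    rw [X, monomial_mul, one_mul]
  have h2 := hφ (Finsupp.single i 1 + s)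
  rw [map_add, Finsupp.degree_single, pow_add, pow_one, ← mul_assoc] at h2
  rwa [LinearMap.comp_apply, LinearMap.mulLeft_apply, h]

lemma norm_map_linForm_pow_le {φ : MvPolynomial (Fin d) ℂ →ₗ[ℂ] ℂ} {C D : ℝ}
    (hφ : ∀ s, ‖φ (monomial s 1)‖ ≤ C * D ^ s.degree) (y : EuclideanSpace ℝ (Fin d)) (l : ℕ) :
    ‖φ (linForm y ^ l)‖ ≤ C * (D * ∑ i, ‖y i‖) ^ l := by
  induction l generalizing φ C with
  | zero => simpa using hφ 0
  | succ l ih =>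
    rw [pow_succ', map_linForm_mul]
    calc ‖∑ i, (y i : ℂ) * φ (X i * linForm y ^ l)‖
        ≤ ∑ i, ‖y i‖ * (C * D * (D * ∑ i, ‖y i‖) ^ l) := by
          refine norm_sum_le_of_le _ fun i _ => ?_
          rw [norm_mul, Complex.norm_real]
          exact mul_le_mul_of_nonneg_left (ih (norm_map_X_mul_monomial_le hφ i)) (norm_nonneg _)
      _ = C * (D * ∑ i, ‖y i‖) ^ (l + 1) := by
          rw [← Finset.sum_mul]
          ring

lemma norm_map_normSqPoly_pow_mul_linForm_pow_le {φ : MvPolynomial (Fin d) ℂ →ₗ[ℂ] ℂ} {C D : ℝ}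
    (hφ : ∀ s, ‖φ (monomial s 1)‖ ≤ C * D ^ s.degree) (y : EuclideanSpace ℝ (Fin d)) (m l : ℕ) :
    ‖φ (normSqPoly d ^ m * linForm y ^ l)‖ ≤ C * (d * D ^ 2) ^ m * (D * ∑ i, ‖y i‖) ^ l := by
  induction m generalizing φ C with
  | zero => simpa using norm_map_linForm_pow_le hφ y l
  | succ m ih =>
    rw [pow_succ', mul_assoc, normSqPoly, Finset.sum_mul, map_sum, ← normSqPoly]
    calc ‖∑ i, φ (X i ^ 2 * (normSqPoly d ^ m * linForm y ^ l))‖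
        ≤ ∑ i : Fin d, C * D * D * (d * D ^ 2) ^ m * (D * ∑ i, ‖y i‖) ^ l := by
          refine norm_sum_le_of_le _ fun i _ => ?_
          have h := ih (norm_map_X_mul_monomial_le (norm_map_X_mul_monomial_le hφ i) i)
          simpa [pow_two, mul_assoc] using h
      _ = C * (d * D ^ 2) ^ (m + 1) * (D * ∑ i, ‖y i‖) ^ l := by
          rw [Finset.sum_const, Finset.card_univ, Fintype.card_fin, nsmul_eq_mul]
          ring

/-! ### The kernel -/

lemma kernelTerm_eq_tsum (x y : EuclideanSpace ℝ (Fin d)) (n : ℕ) :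
    kernelTerm S k x y n = ∑' m : ℕ, ((-1 / 2 : ℂ) ^ m / (m.factorial : ℂ)) *
      ((n.descFactorial (2 * m) : ℂ) * (1 / (n.factorial : ℂ) *
        evalAt x (intertwiner S k (normSqPoly d ^ m * linForm y ^ (n - 2 * m))))) := by
  refine tsum_congr fun m => ?_
  congr 1
  exact congrFun (iterate_laplacian_linForm_pow
    ((1 / (n.factorial : ℂ)) • evalAtLin x ∘ₗ (intertwiner S k).toLinearMap) n m) y

/-- The kernel terms inherit the symmetries of the intertwining operator. -/
lemma kernelTerm_apply {h : EuclideanSpace ℝ (Fin d) ≃ₗᵢ[ℝ] EuclideanSpace ℝ (Fin d)}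
    (hh : ∀ n p, p.IsHomogeneous n → act h (intertwiner S k p) = intertwiner S k (act h p))
    (x y : EuclideanSpace ℝ (Fin d)) (n : ℕ) :
    kernelTerm S k (h x) y n = kernelTerm S k x (h⁻¹ y) n := by
  rw [kernelTerm_eq_tsum, kernelTerm_eq_tsum]
  refine tsum_congr fun m => ?_
  have hQ : (normSqPoly d).IsHomogeneous 2 :=
    IsHomogeneous.sum _ _ _ fun i _ => isHomogeneous_X_pow i 2
  rw [← evalAt_act, hh _ _ ((hQ.pow m).mul ((isHomogeneous_linForm y).pow _)), map_mul, map_pow,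
    map_pow, act_normSqPoly, act_linForm]

lemma kernelL_apply {h : EuclideanSpace ℝ (Fin d) ≃ₗᵢ[ℝ] EuclideanSpace ℝ (Fin d)}
    (hh : ∀ n p, p.IsHomogeneous n → act h (intertwiner S k p) = intertwiner S k (act h p))
    (x y : EuclideanSpace ℝ (Fin d)) :
    kernelL S k (h x) y = kernelL S k x (h⁻¹ y) :=
  tsum_congr fun n => kernelTerm_apply hh x y n

theorem summable_kernelTerm (hV : IsIntertwining S k (intertwiner S k))
    (x y : EuclideanSpace ℝ (Fin d)) : Summable (kernelTerm S k x y) := by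
  obtain ⟨C, hC0, hC⟩ := hV.exists_norm_evalAt_le (norm_nonneg x)
  set D := 2 * ‖x‖ + 1
  have hD : 0 ≤ D := by positivity
  have hφ (s : Fin d →₀ ℕ) : ‖(evalAtLin x ∘ₗ (intertwiner S k).toLinearMap) (monomial s 1)‖ ≤
      C * D ^ s.degree := hC s x le_rfl
  let F : ℕ × ℕ → ℂ := fun q => ((-1 / 2 : ℂ) ^ q.2 / (q.2.factorial : ℂ)) *
    ((q.1.descFactorial (2 * q.2) : ℂ) * (1 / (q.1.factorial : ℂ) *
      evalAt x (intertwiner S k (normSqPoly d ^ q.2 * linForm y ^ (q.1 - 2 * q.2)))))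
  suffices hF : Summable F by
    refine hF.prod.congr fun n => ?_
    exact (kernelTerm_eq_tsum x y n).symm
  -- Reindexing by `n = 2m + l`: outside the image of `e`, where `n < 2m`, the falling factorial
  -- vanishes, and on it the quotient by `n!` becomes `1 / l!`, which decouples `m` from `l`.
  let e : ℕ × ℕ → ℕ × ℕ := fun q => (2 * q.1 + q.2, q.1)
  have he : Function.Injective e := by
    rintro ⟨a, b⟩ ⟨a', b'⟩ h
    simp only [e, Prod.mk.injEq] at h ⊢
    omega
  refine (he.summable_iff ?_).1 ?_
  · rintro ⟨n, m⟩ hnm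
    have h : n < 2 * m := by
      by_contra hlt
      exact hnm ⟨(m, n - 2 * m), by simp only [e]; rw [Nat.add_sub_cancel' (not_lt.1 hlt)]⟩
    simp [F, Nat.descFactorial_eq_zero_iff_lt.2 h]
  · refine Summable.of_norm_bounded
      (g := fun q : ℕ × ℕ => C * ((d * D ^ 2 / 2) ^ q.1 / q.1.factorial *
        ((D * ∑ i, ‖y i‖) ^ q.2 / q.2.factorial))) ?_ ?_
    · refine Summable.mul_left C (Summable.mul_of_nonneg (Real.summable_pow_div_factorial _)
        (Real.summable_pow_div_factorial _) ?_ ?_)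
      · intro m
        positivity
      · intro l
        positivity
    · rintro ⟨m, l⟩
      have h1 := norm_map_normSqPoly_pow_mul_linForm_pow_le hφ y m l
      have h2 : ((2 * m + l).descFactorial (2 * m) : ℝ) * (1 / ((2 * m + l).factorial : ℝ)) =
          1 / (l.factorial : ℝ) := by
        have h := Nat.factorial_mul_descFactorial (n := 2 * m + l) (k := 2 * m) (by omega)
        rw [Nat.add_sub_cancel_left] at h
        rw [← h]
        have := Nat.factorial_ne_zero l
        have h3 : (2 * m + l).descFactorial (2 * m) ≠ 0 := by
          rw [Ne, Nat.descFactorial_eq_zero_iff_lt]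
          omega
        push_cast
        field_simp
      have h4 : ‖(F ∘ e) (m, l)‖ = (1 / 2) ^ m / m.factorial * (1 / l.factorial *
          ‖(evalAtLin x ∘ₗ (intertwiner S k).toLinearMap)
            (normSqPoly d ^ m * linForm y ^ l)‖) := by
        rw [← h2]
        simp only [F, e, Function.comp_apply, Nat.add_sub_cancel_left, norm_mul, norm_div, norm_pow,
          norm_neg, norm_one, Complex.norm_natCast, Complex.norm_ofNat, mul_assoc]
        rfl
      rw [h4]
      calc _ ≤ (1 / 2) ^ m / m.factorial * (1 / l.factorial *
            (C * (d * D ^ 2) ^ m * (D * ∑ i, ‖y i‖) ^ l)) := by gcongr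
        _ = _ := by
          rw [div_pow, div_pow, one_pow]
          ring

end DunklKernel
end

theorem mainTheorem8 {d : ℕ} (R : Finset (EuclideanSpace ℝ (Fin d)))
    (hR : DunklKernel.IsRootSystem R)
    (β : EuclideanSpace ℝ (Fin d)) (hβ : ∀ α ∈ R, inner ℝ α β ≠ 0)
    (k : EuclideanSpace ℝ (Fin d) → ℂ)
    (hk : ∀ g ∈ DunklKernel.reflectionGroup R, ∀ α ∈ R, k (g α) = k α)
    (hM : DunklKernel.IsInvertibleParam (DunklKernel.posRoots R β) k) :
    (∃! V : MvPolynomial (Fin d) ℂ ≃ₗ[ℂ] MvPolynomial (Fin d) ℂ,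
      DunklKernel.IsIntertwining (DunklKernel.posRoots R β) k V) ∧
    (∀ x y : EuclideanSpace ℝ (Fin d),
      Summable (DunklKernel.kernelTerm (DunklKernel.posRoots R β) k x y)) ∧
    (∀ x y : EuclideanSpace ℝ (Fin d),
      DunklKernel.kernelL (DunklKernel.posRoots R β) k (-x) y =
        DunklKernel.kernelL (DunklKernel.posRoots R β) k x (-y)) ∧
    (∀ g ∈ DunklKernel.reflectionGroup R, ∀ x y : EuclideanSpace ℝ (Fin d),
      DunklKernel.kernelL (DunklKernel.posRoots R β) k (g x) y =
        DunklKernel.kernelL (DunklKernel.posRoots R β) k x (g⁻¹ y)) := by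
  have hex := DunklKernel.exists_isIntertwining k
    (fun α => hR.ne_zero_of_mem_posRoots) (DunklKernel.dunklOp_comm hR hβ hk) hM
  have hV := DunklKernel.isIntertwining_intertwiner hex
  refine ⟨⟨_, hV, fun W hW => hW.unique hM hV⟩, DunklKernel.summable_kernelTerm hV,
    fun x y => ?_, fun g hg x y => ?_⟩
  · refine DunklKernel.kernelL_apply (h := LinearIsometryEquiv.neg ℝ) (fun n p hp => ?_) x y
    rw [DunklKernel.act_neg hp, DunklKernel.act_neg (hV.homogeneous n p hp), map_smul]
  · exact DunklKernel.kernelL_apply (fun n p _ => hV.act_comm hR hβ hk hM hg p) x y
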